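/- Let $\mathcal L$ be an essentially small tensor-triangulated category, i.e. a triangulated category with a symmetric monoidal structure $(\otimes,\mathbb 1)$ that is exact in each variable (with isomorphisms $X\otimes\Sigma Y\cong\Sigma(X\otimes Y)$ natural in both variables). For such a category $\mathcal C$, let $\mathrm{Spc}(\mathcal C)$ be the set of its prime tt-ideals, i.e. the proper thick triangulated $\otimes$-ideals $\mathcal P\subsetneq\mathcal C$ such that $X\otimes Y\in\mathcal P$ implies $X\in\mathcal P$ or $Y\in\mathcal P$. For a $\otimes$-invertible object $u\in\mathcal C$, let $R^\bullet_{\mathcal C,u}=\mathrm{Hom}_{\mathcal C}(\mathbb 1,u^{\otimes\bullet})$ be the associated $\mathbb Z$-graded ring, with the product of $f\colon\mathbb 1\to u^{\otimes m}$ and $g\colon\mathbb 1\to u^{\otimes n}$ given by $f\otimes g\colon\mathbb 1\to u^{\otimes m}\otimes u^{\otimes n}\cong u^{\otimes(m+n)}$; let $\mathrm{Spec}^\bullet(R^\bullet_{\mathcal C,u})$ be the set of its homogeneous prime ideals, and let $$\rho^\bullet_{\mathcal C,u}\colon\mathrm{Spc}(\mathcal C)\to\mathrm{Spec}^\bullet(R^\bullet_{\mathcal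 C,u})$$ be the comparison map, which sends $\mathcal P$ to the homogeneous prime ideal whose homogeneous elements are the $f$ with $\mathrm{cone}(f)\notin\mathcal P$. Let $u\in\mathcal L$ be $\otimes$-invertible and let $\mathcal K\subseteq\mathcal L$ be the full thick triangulated subcategory generated by $\{u^{\otimes n}\mid n\in\mathbb Z\}$ (a tensor-triangulated subcategory containing $u$). Suppose that $\mathcal K$ is rigid, i.e. every object of $\mathcal K$ has a dual in $\mathcal K$. Then: 1. The inclusion $\mathcal K\subseteq\mathcal L$ induces an isomorphism of graded rings $R^\bullet_{\mathcal K,u}=\mathrm{Hom}_{\mathcal K}(\mathbb 1,u^{\otimes\bullet})\cong\mathrm{Hom}_{\mathcal L}(\mathbb 1,u^{\otimes\bullet})=R^\bullet_{\mathcal L,u}$. 2. Under this identification, $\rho^\bullet_{\mathcal K,u}(\mathcal Q\cap\mathcal K)=\rho^\bullet_{\mathcal L,u}(\mathcal Q)$ for every $\mathcal Q\in\mathrm{Spc}(\mathcal L)$, and the map $\mathrm{Spc}(\mathcal L)\to\mathrm{Spc}(\mathcal K)$, $\mathcal Q\mapsto\mathcal Q\cap\mathcal K$, is surjective. 3. If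 $\rho^\bullet_{\mathcal K,u}$ is surjective, then $\rho^\bullet_{\mathcal L,u}$ is surjective. -/

import Mathlib

open CategoryTheory MonoidalCategory Limits

universe v u

namespace TTGeometry

noncomputable section

variable {C : Type u} [Category.{v} C] [MonoidalCategory C]

/-- An object `x` is `⊗`-invertible if `x ⊗ y ≅ 𝟙` for some `y`. -/
def IsTensorInvertible (x : C) : Prop :=
  ∃ y : C, Nonempty (x ⊗ y ≅ 𝟙_ C)

/-- The iterated tensor power `x^{⊗ n}`, for `n` a natural number. -/
def tensorNPow (x : C) : ℕ → C
  | 0 => 𝟙_ C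
  | n + 1 => tensorNPow x n ⊗ x

/-- A realization of the integral tensor powers of `x`: a `ℤ`-indexed family of objects, starting
with the unit, in which each step is `- ⊗ x`. (Such a family exists only if `x` is
`⊗`-invertible, and it is then unique up to isomorphism.) -/
structure TensorPowers (x : C) where
  /-- the object `x^{⊗ n}` -/
  obj : ℤ → C
  /-- `x^{⊗ 0}` is the unit -/
  zero : 𝟙_ C ≅ obj 0
  /-- `x^{⊗ n} ⊗ x` is `x^{⊗ (n + 1)}` -/
  succ (n : ℤ) : obj n ⊗ x ≅ obj (n + 1)

namespace IsTensorInvertible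

variable [SymmetricCategory C] {x : C} (hx : IsTensorInvertible x)
/-- A chosen `⊗`-inverse. -/
def inverse : C := hx.choose

/-- The isomorphism expressing that `inverse` is an inverse. -/
def inverseTensorIso : hx.inverse ⊗ x ≅ 𝟙_ C :=
  (β_ _ _) ≪≫ hx.choose_spec.some

/-- The integral tensor powers of a `⊗`-invertible object `x`: the usual ones in
non-negative degrees, and the powers of the inverse in negative degrees. -/
def powers : TensorPowers x where
  obj
    | Int.ofNat n => tensorNPow x n
    | Int.negSucc n => tensorNPow hx.inverse (n + 1)
  zero := Iso.refl _
  succ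
    | Int.ofNat _ => Iso.refl _
    | Int.negSucc 0 => α_ _ _ _ ≪≫ whiskerLeftIso _ hx.inverseTensorIso ≪≫ ρ_ _
    | Int.negSucc (_ + 1) => α_ _ _ _ ≪≫ whiskerLeftIso _ hx.inverseTensorIso ≪≫ ρ_ _

end IsTensorInvertible

namespace TensorPowers

variable {x : C} (T : TensorPowers x)

/-- The isomorphism `x^{⊗ a} ⊗ x ≅ x^{⊗ b}` when `a + 1 = b`. -/
def succ' (a b : ℤ) (h : a + 1 = b) : T.obj a ⊗ x ≅ T.obj b :=
  T.succ a ≪≫ eqToIso (by rw [h])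

/-- The identification `x^{⊗ a} ≅ x^{⊗ b}` when `a = b`. -/
def cast {a b : ℤ} (h : a = b) : T.obj a ≅ T.obj b := eqToIso (by rw [h])

@[simp] lemma cast_refl (a : ℤ) : T.cast (rfl : a = a) = Iso.refl _ := rfl

variable [SymmetricCategory C]

/-- An inverse of `x` coming from the powers. -/
def negOneIso : x ⊗ T.obj (-1) ≅ 𝟙_ C :=
  (β_ _ _) ≪≫ T.succ' (-1) 0 (by norm_num) ≪≫ T.zero.symm

lemma tensor_unit_naturality {y : C} (e : x ⊗ y ≅ 𝟙_ C) {X Y : C} (f : X ⟶ Y) :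
    f ≫ (ρ_ Y).inv ≫ Y ◁ e.inv ≫ (α_ Y x y).inv =
      ((ρ_ X).inv ≫ X ◁ e.inv ≫ (α_ X x y).inv) ≫ f ▷ x ▷ y := by
  have h : (α_ X x y).inv ≫ f ▷ x ▷ y = f ▷ (x ⊗ y) ≫ (α_ Y x y).inv := by simp
  simp only [Category.assoc, h, whisker_exchange_assoc]
  simp

lemma tensor_counit_naturality {y : C} (e : y ⊗ x ≅ 𝟙_ C) {X Y : C} (f : X ⟶ Y) :
    f ▷ y ▷ x ≫ (α_ Y y x).hom ≫ Y ◁ e.hom ≫ (ρ_ Y).hom =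
      ((α_ X y x).hom ≫ X ◁ e.hom ≫ (ρ_ X).hom) ≫ f := by
  simp only [Category.assoc, associator_naturality_left_assoc, ← whisker_exchange_assoc]
  simp

lemma isEquivalence_tensorRight {y : C} (e : x ⊗ y ≅ 𝟙_ C) : (tensorRight x).IsEquivalence := by
  let E : C ≌ C := CategoryTheory.Equivalence.mk (tensorRight x) (tensorRight y)
    (NatIso.ofComponents (fun X => (ρ_ X).symm ≪≫ whiskerLeftIso X e.symm ≪≫
        (α_ X x y).symm) (fun f => tensor_unit_naturality e f))
    (NatIso.ofComponents (fun X => α_ X y x ≪≫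
      whiskerLeftIso X ((β_ _ _) ≪≫ e) ≪≫ ρ_ X)
      (fun f => tensor_counit_naturality ((β_ _ _) ≪≫ e) f))
  exact E.isEquivalence_functor

/-- Tensoring with a `⊗`-invertible object is fully faithful. -/
def fullyFaithful (T : TensorPowers x) : (tensorRight x).FullyFaithful :=
  haveI := isEquivalence_tensorRight T.negOneIso
  Functor.FullyFaithful.ofFullyFaithful _

/-- If `a + 1 = b`, a map `X ⊗ x^{⊗ b} ≅ x^{⊗ (l + b)}` is obtained from a map
`X ⊗ x^{⊗ a} ≅ x^{⊗ (l + a)}` by tensoring with `x`. -/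
def mulUp (l : ℤ) {X : C} {a b : ℤ} (h : a + 1 = b) (p : X ⊗ T.obj a ≅ T.obj (l + a)) :
    X ⊗ T.obj b ≅ T.obj (l + b) :=
  whiskerLeftIso X (T.succ' a b h).symm ≪≫ (α_ _ _ _).symm ≪≫ whiskerRightIso p x ≪≫
    T.succ' (l + a) (l + b) (by lia)

/-- The inverse construction to `mulUp`. -/
def mulDown (l : ℤ) {X : C} {a b : ℤ} (h : a + 1 = b) (p : X ⊗ T.obj b ≅ T.obj (l + b)) :
    X ⊗ T.obj a ≅ T.obj (l + a) :=
  T.fullyFaithful.preimageIso (α_ _ _ _ ≪≫ whiskerLeftIso X (T.succ' a b h) ≪≫ p ≪≫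
    (T.succ' (l + a) (l + b) (by lia)).symm)

/-- The condition relating `p : X ⊗ x^{⊗ a} ⟶ x^{⊗ (l + a)}` and
`q : X ⊗ x^{⊗ b} ⟶ x^{⊗ (l + b)}`, when `a + 1 = b`, that `q` is `p ⊗ x`. -/
def MulRel (l : ℤ) {X : C} {a b : ℤ} (h : a + 1 = b) (p : X ⊗ T.obj a ⟶ T.obj (l + a))
    (q : X ⊗ T.obj b ⟶ T.obj (l + b)) : Prop :=
  p ▷ x ≫ (T.succ' (l + a) (l + b) (by lia)).hom =
    (α_ _ _ _).hom ≫ X ◁ (T.succ' a b h).hom ≫ q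

lemma mulRel_mulUp (l : ℤ) {X : C} {a b : ℤ} (h : a + 1 = b) (p : X ⊗ T.obj a ≅ T.obj (l + a)) :
    T.MulRel l h p.hom (T.mulUp l h p).hom := by
  simp [MulRel, mulUp]

lemma mulRel_mulDown (l : ℤ) {X : C} {a b : ℤ} (h : a + 1 = b)
    (p : X ⊗ T.obj b ≅ T.obj (l + b)) :
    T.MulRel l h (T.mulDown l h p).hom p.hom := by
  have := T.fullyFaithful.map_preimage (X := X ⊗ T.obj a) (Y := T.obj (l + a))
    ((α_ _ _ _).hom ≫ X ◁ (T.succ' a b h).hom ≫ p.hom ≫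
    (T.succ' (l + a) (l + b) (by lia)).inv)
  have h2 : (T.mulDown l h p).hom ▷ x = _ := this
  simp [MulRel, h2]

/-- The isomorphism `x^{⊗ m} ⊗ x^{⊗ n} ≅ x^{⊗ (m + n)}` for `n ≥ 0`. -/
def mulIsoNat (m : ℤ) : ∀ n : ℕ, T.obj m ⊗ T.obj (Int.ofNat n) ≅ T.obj (m + Int.ofNat n)
  | 0 => whiskerLeftIso _ T.zero.symm ≪≫ ρ_ _ ≪≫ T.cast (by simp)
  | n + 1 => T.mulUp m (a := Int.ofNat n) (by simp) (mulIsoNat m n)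

/-- The isomorphism `x^{⊗ m} ⊗ x^{⊗ n} ≅ x^{⊗ (m + n)}` for `n < 0`. -/
def mulIsoNeg (m : ℤ) : ∀ n : ℕ, T.obj m ⊗ T.obj (Int.negSucc n) ≅ T.obj (m + Int.negSucc n)
  | 0 => T.mulDown m (b := Int.ofNat 0) (by simp) (T.mulIsoNat m 0)
  | n + 1 => T.mulDown m (b := Int.negSucc n) (by lia) (mulIsoNeg m n)

/-- The canonical isomorphism `x^{⊗ m} ⊗ x^{⊗ n} ≅ x^{⊗ (m + n)}`: the unitor for `n = 0`,
and compatible with tensoring by `x` on the right. -/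
def mulIso (m : ℤ) : ∀ n : ℤ, T.obj m ⊗ T.obj n ≅ T.obj (m + n)
  | Int.ofNat n => T.mulIsoNat m n
  | Int.negSucc n => T.mulIsoNeg m n

lemma mulIso_zero (m : ℤ) :
    (T.mulIso m 0).hom = T.obj m ◁ T.zero.inv ≫ (ρ_ _).hom ≫ (T.cast (by simp)).hom := by
  rfl

lemma mulIso_rel (m : ℤ) {a b : ℤ} (h : a + 1 = b) :
    T.MulRel m h (T.mulIso m a).hom (T.mulIso m b).hom := by
  subst h
  match a with
  | Int.ofNat n =>
    exact T.mulRel_mulUp m (a := Int.ofNat n) (b := Int.ofNat (n + 1)) (by simp) (T.mulIsoNat m n)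
  | Int.negSucc 0 =>
    exact T.mulRel_mulDown m (a := Int.negSucc 0) (b := Int.ofNat 0) (by simp) (T.mulIsoNat m 0)
  | Int.negSucc (n + 1) =>
    exact T.mulRel_mulDown m (a := Int.negSucc (n + 1)) (b := Int.negSucc n) (by lia)
      (T.mulIsoNeg m n)

lemma MulRel.right_unique {l : ℤ} {X : C} {a b : ℤ} {h : a + 1 = b}
    {p : X ⊗ T.obj a ⟶ T.obj (l + a)} {q q' : X ⊗ T.obj b ⟶ T.obj (l + b)}
    (h₁ : T.MulRel l h p q) (h₂ : T.MulRel l h p q') : q = q' := by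
  have := h₁.symm.trans h₂
  rwa [cancel_epi, cancel_epi] at this

lemma MulRel.left_unique {l : ℤ} {X : C} {a b : ℤ} {h : a + 1 = b}
    {p p' : X ⊗ T.obj a ⟶ T.obj (l + a)} {q : X ⊗ T.obj b ⟶ T.obj (l + b)}
    (h₁ : T.MulRel l h p q) (h₂ : T.MulRel l h p' q) : p = p' := by
  have := h₁.trans h₂.symm
  rw [cancel_mono] at this
  exact T.fullyFaithful.map_injective this

lemma eq_of_mulRel {l : ℤ} {X : C} (p q : ∀ a, X ⊗ T.obj a ⟶ T.obj (l + a))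
    (hp : ∀ a, T.MulRel l rfl (p a) (p (a + 1))) (hq : ∀ a, T.MulRel l rfl (q a) (q (a + 1)))
    (h0 : p 0 = q 0) (a : ℤ) : p a = q a := by
  induction a using Int.induction_on with
  | zero => exact h0
  | succ n ih => exact MulRel.right_unique T (hp n) (ih ▸ hq n)
  | pred n ih =>
    have h1 := hp (-(n : ℤ) - 1)
    have h2 := hq (-(n : ℤ) - 1)
    have e : p (-(n : ℤ) - 1 + 1) = q (-(n : ℤ) - 1 + 1) := by
      rw [show -(n : ℤ) - 1 + 1 = -(n : ℤ) by lia]; exact ih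
    exact MulRel.left_unique T (e ▸ h1) h2

lemma succ'_cast {a b b' : ℤ} (h : a + 1 = b) (h' : b = b') :
    (T.succ' a b h).hom ≫ (T.cast h').hom = (T.succ' a b' (h.trans h')).hom := by
  subst h'; simp

lemma cast_succ' {a a' b : ℤ} (h : a' + 1 = b) (h' : a = a') :
    (T.cast h').hom ▷ x ≫ (T.succ' a' b h).hom = (T.succ' a b (by lia)).hom := by
  subst h'; simp

@[simp] lemma cast_cast {a b c : ℤ} (h : a = b) (h' : b = c) :
    (T.cast h).hom ≫ (T.cast h').hom = (T.cast (h.trans h')).hom := by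
  subst h h'; simp

lemma cast_mulIso {a a' b : ℤ} (h : a = a') :
    (T.cast h).hom ▷ T.obj b ≫ (T.mulIso a' b).hom =
      (T.mulIso a b).hom ≫ (T.cast (by rw [h])).hom := by
  subst h; simp

lemma mulIso_cast {a b b' : ℤ} (h : b = b') :
    T.obj a ◁ (T.cast h).hom ≫ (T.mulIso a b').hom =
      (T.mulIso a b).hom ≫ (T.cast (by rw [h])).hom := by
  subst h; simp

lemma zero_mulIso (n : ℤ) :
    T.zero.hom ▷ T.obj n ≫ (T.mulIso 0 n).hom = (λ_ _).hom ≫ (T.cast (by simp)).hom := by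
  refine T.eq_of_mulRel (l := 0) (X := 𝟙_ C)
    (fun n => T.zero.hom ▷ T.obj n ≫ (T.mulIso 0 n).hom)
    (fun n => (λ_ _).hom ≫ (T.cast (by simp)).hom) ?_ ?_ ?_ n
  · intro a
    have := T.mulIso_rel 0 (a := a) rfl
    dsimp [MulRel] at this ⊢
    rw [comp_whiskerRight_assoc, this]
    simp only [whisker_exchange_assoc, associator_naturality_left_assoc]
  · intro a
    dsimp [MulRel]
    rw [comp_whiskerRight_assoc, cast_succ']
    simp [succ'_cast]
  · rw [mulIso_zero, ← whisker_exchange_assoc, ← cancel_epi (𝟙_ C ◁ T.zero.hom)]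
    simp [← unitors_equal]

lemma mulIso_assoc (m n k : ℤ) :
    (T.mulIso m n).hom ▷ T.obj k ≫ (T.mulIso (m + n) k).hom =
      (α_ _ _ _).hom ≫ T.obj m ◁ (T.mulIso n k).hom ≫ (T.mulIso m (n + k)).hom ≫
        (T.cast (by lia)).hom := by
  refine T.eq_of_mulRel (l := m + n) (X := T.obj m ⊗ T.obj n)
    (fun k => (T.mulIso m n).hom ▷ T.obj k ≫ (T.mulIso (m + n) k).hom)
    (fun k => (α_ _ _ _).hom ≫ T.obj m ◁ (T.mulIso n k).hom ≫ (T.mulIso m (n + k)).hom ≫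
        (T.cast (by lia)).hom) ?_ ?_ ?_ k
  · intro a
    have := T.mulIso_rel (m + n) (a := a) rfl
    dsimp [MulRel] at this ⊢
    rw [comp_whiskerRight_assoc, this]
    simp only [whisker_exchange_assoc, associator_naturality_left_assoc]
  · intro a
    have h1 := T.mulIso_rel n (a := a) rfl
    have h2 := T.mulIso_rel m (a := n + a) (b := n + (a + 1)) (by lia)
    dsimp [MulRel] at h1 h2 ⊢
    simp only [comp_whiskerRight, Category.assoc]
    rw [cast_succ', ← succ'_cast T (b := m + (n + (a + 1))) (by lia) (by lia), reassoc_of% h2    ]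
    have h3 : T.obj m ◁ ((T.mulIso n a).hom ▷ x) ≫ T.obj m ◁ (T.succ' (n + a) (n + (a + 1)) (by lia)).hom = _ :=
      (MonoidalCategory.whiskerLeft_comp _ _ _).symm.trans (congrArg (fun f => T.obj m ◁ f) h1)
    simp only [MonoidalCategory.whiskerLeft_comp] at h3
    simp only [associator_naturality_middle_assoc, reassoc_of% h3,
      pentagon_assoc, associator_naturality_right_assoc]
  · have h := T.mulIso_cast (a := m) (b := n) (b' := n + 0) (by simp)
    simp only [mulIso_zero, ← whisker_exchange_assoc, MonoidalCategory.whiskerLeft_comp, Category.assoc,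
      rightUnitor_naturality_assoc]
    rw [reassoc_of% h]
    simp

/-- The degree `n` part `Hom(𝟙, x^{⊗ n})` of the graded ring `Hom(𝟙, x^{⊗ •})`. -/
abbrev R (n : ℤ) : Type v := 𝟙_ C ⟶ T.obj n

/-- The product of `f : 𝟙 ⟶ x^{⊗ m}` and `g : 𝟙 ⟶ x^{⊗ n}` is `f ⊗ g`, viewed as a morphism
`𝟙 ≅ 𝟙 ⊗ 𝟙 ⟶ x^{⊗ m} ⊗ x^{⊗ n} ≅ x^{⊗ (m + n)}`. -/
def mul {m n : ℤ} (f : T.R m) (g : T.R n) : T.R (m + n) :=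
  (λ_ (𝟙_ C)).inv ≫ (f ⊗ₘ g) ≫ (T.mulIso m n).hom

lemma gradedMonoid_ext {a b : ℤ} (h : a = b) (f : T.R a) (g : T.R b)
    (hfg : f ≫ (T.cast h).hom = g) : GradedMonoid.mk (A := T.R) a f = GradedMonoid.mk b g := by
  subst h hfg
  simp

instance : GradedMonoid.GMul T.R where
  mul f g := T.mul f g

instance : GradedMonoid.GOne T.R where
  one := T.zero.hom

instance : GradedMonoid.GMonoid T.R where
  one_mul := by
    rintro ⟨n, f⟩
    refine T.gradedMonoid_ext (zero_add n) (T.mul T.zero.hom f) f ?_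
    simp only [mul, tensorHom_def', Category.assoc, reassoc_of% T.zero_mulIso]
    simp
  mul_one := by
    rintro ⟨n, f⟩
    refine T.gradedMonoid_ext (add_zero n) (T.mul f T.zero.hom) f ?_
    simp only [mul, MonoidalCategory.tensorHom_def, Category.assoc, mulIso_zero]
    simp [unitors_inv_equal]
  mul_assoc := by
    rintro ⟨m, f⟩ ⟨n, g⟩ ⟨k, h⟩
    refine T.gradedMonoid_ext (add_assoc m n k) (T.mul (T.mul f g) h) (T.mul f (T.mul g h)) ?_
    have e : T.mul f g ⊗ₘ h = (λ_ (𝟙_ C)).inv ▷ 𝟙_ C ≫ ((f ⊗ₘ g) ⊗ₘ h) ≫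
        (T.mulIso m n).hom ▷ T.obj k := by
      simp only [mul, ← tensorHom_id, tensorHom_comp_tensorHom, Category.id_comp,
        Category.comp_id]
    have e' : f ⊗ₘ T.mul g h = 𝟙_ C ◁ (λ_ (𝟙_ C)).inv ≫ (f ⊗ₘ (g ⊗ₘ h)) ≫
        T.obj m ◁ (T.mulIso n k).hom := by
      simp only [mul, ← id_tensorHom, tensorHom_comp_tensorHom, Category.id_comp,
        Category.comp_id]
    rw [mul, e, mul, e']
    simp only [Category.assoc, reassoc_of% T.mulIso_assoc, cast_cast, cast_refl, Iso.refl_hom,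
      Category.comp_id, associator_naturality_assoc]
    have c : (λ_ (𝟙_ C)).inv ≫ (λ_ (𝟙_ C)).inv ▷ 𝟙_ C ≫ (α_ _ _ _).hom =
        (λ_ (𝟙_ C)).inv ≫ 𝟙_ C ◁ (λ_ (𝟙_ C)).inv := by monoidal
    rw [reassoc_of% c]

variable [Preadditive C] [MonoidalPreadditive C]

instance : DirectSum.GRing T.R where
  mul_zero f := by change T.mul f 0 = 0; simp [mul]
  zero_mul f := by change T.mul 0 f = 0; simp [mul]
  mul_add f g h := by
    change T.mul f (g + h) = T.mul f g + T.mul f h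
    simp [mul, MonoidalPreadditive.tensor_add]
  add_mul f g h := by
    change T.mul (f + g) h = T.mul f h + T.mul g h
    simp [mul, MonoidalPreadditive.add_tensor]
  natCast n := n • T.zero.hom
  natCast_zero := by simp
  natCast_succ n := by simp [add_smul]; rfl
  intCast n := n • T.zero.hom
  intCast_ofNat n := by simp
  intCast_negSucc_ofNat n := by simp [Int.negSucc_eq, add_smul]

end TensorPowers
section TensorTriangulated

variable (C) [SymmetricCategory C] [Preadditive C] [HasZeroObject C] [HasShift C ℤ]
  [∀ n : ℤ, (shiftFunctor C n).Additive] [Pretriangulated C]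

/-- The compatibility between a symmetric monoidal structure and a triangulation: the tensor
product is exact in each variable. It suffices to say it for the functors `X ⊗ -`, thanks to the
symmetry. The isomorphisms `X ⊗ Y⟦n⟧ ≅ (X ⊗ Y)⟦n⟧` are natural in both variables. -/
class TensorTriangulated where
  /-- `X ⊗ -` commutes with the shift -/
  commShift (X : C) : (tensorLeft X).CommShift ℤ
  /-- `X ⊗ -` preserves distinguished triangles -/
  isTriangulated (X : C) : (tensorLeft X).IsTriangulated
  /-- the isomorphisms `X ⊗ Y⟦n⟧ ≅ (X ⊗ Y)⟦n⟧` are natural in `X` -/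
  natural {X Y : C} (f : X ⟶ Y) : NatTrans.CommShift ((curriedTensor C).map f) ℤ

attribute [reducible] TensorTriangulated.commShift
attribute [instance] TensorTriangulated.commShift TensorTriangulated.isTriangulated
  TensorTriangulated.natural

variable [TensorTriangulated C]
variable {C}

instance monoidalPreadditive : MonoidalPreadditive C where
  whiskerLeft_zero {X Y Z} := (tensorLeft X).map_zero Y Z
  whiskerLeft_add {X Y Z} f g := (tensorLeft X).map_add
  zero_whiskerRight {X Y Z} := by
    have h : X ◁ (0 : Y ⟶ Z) = 0 := (tensorLeft X).map_zero Y Z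
    have := BraidedCategory.braiding_naturality_left (0 : Y ⟶ Z) X
    rwa [h, comp_zero, ← zero_comp (f := (β_ Z X).hom), cancel_mono] at this
  add_whiskerRight {X Y Z} f g := by
    have h : X ◁ (f + g) = X ◁ f + X ◁ g := (tensorLeft X).map_add
    have := BraidedCategory.braiding_naturality_left (f + g) X
    rw [h, Preadditive.comp_add, ← BraidedCategory.braiding_naturality_left,
      ← BraidedCategory.braiding_naturality_left, ← Preadditive.add_comp, cancel_mono] at this
    exact this

section FullSubcategory

variable (P : ObjectProperty C) [P.IsMonoidal] [P.IsTriangulated]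

/-- The functor `X ⊗ -` of a full monoidal subcategory is the restriction of the ambient one. -/
def tensorLeftCompι (X : P.FullSubcategory) :
    tensorLeft X ⋙ P.ι ≅ P.ι ⋙ tensorLeft X.obj :=
  NatIso.ofComponents (fun _ => Iso.refl _) (fun f => by simp)

/-- A triangulated full subcategory closed under tensor products is tensor triangulated. -/
instance tensorTriangulatedFullSubcategory : TensorTriangulated P.FullSubcategory where
  commShift X := Functor.CommShift.ofComp (tensorLeftCompι P X) ℤ
  isTriangulated X := by
    let := Functor.CommShift.ofComp (tensorLeftCompι P X) ℤ
    have : NatTrans.CommShift (tensorLeftCompι P X).hom ℤ :=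
      Functor.CommShift.ofComp_compatibility (tensorLeftCompι P X) ℤ
    rw [Functor.isTriangulated_iff_comp_right (tensorLeftCompι P X)]
    infer_instance
  natural {X Y} f := by
    let := Functor.CommShift.ofComp (tensorLeftCompι P X) ℤ
    let := Functor.CommShift.ofComp (tensorLeftCompι P Y) ℤ
    refine ⟨fun n => NatTrans.ext (funext fun Z => P.ι.map_injective ?_)⟩
    have key (W : P.FullSubcategory) :
        P.ι.map ((Functor.CommShift.OfComp.iso (tensorLeftCompι P W) n).hom.app Z) =
          W.obj ◁ (P.ι.commShiftIso n).hom.app Z ≫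
            ((tensorLeft W.obj).commShiftIso n).hom.app Z.obj ≫
              (P.ι.commShiftIso n).inv.app (W ⊗ Z) := by
      refine (Functor.CommShift.OfComp.map_iso_hom_app (tensorLeftCompι P W) n Z).trans ?_
      have h1 : (tensorLeftCompι P W).hom.app (Z⟦n⟧) = 𝟙 _ := rfl
      have h2 : (tensorLeftCompι P W).inv.app Z = 𝟙 _ := rfl
      rw [h1, h2, CategoryTheory.Functor.map_id]
      refine (Category.id_comp _).trans ?_
      rw [Functor.commShiftIso_comp_hom_app, Category.assoc]
      exact congrArg _ (congrArg _ (Category.id_comp _))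
    have hZ := NatTrans.shift_app_comm ((curriedTensor C).map f.hom) n Z.obj
    have hn := P.ι.commShiftIso_inv_naturality (f ▷ Z) n
    have hw := whisker_exchange f.hom ((P.ι.commShiftIso n).hom.app Z)
    change P.ι.map ((Functor.CommShift.OfComp.iso (tensorLeftCompι P X) n).hom.app Z ≫
      (f ▷ Z)⟦n⟧') = P.ι.map (f ▷ Z⟦n⟧ ≫
        (Functor.CommShift.OfComp.iso (tensorLeftCompι P Y) n).hom.app Z)
    rw [Functor.map_comp, Functor.map_comp, key X, key Y]
    simp only [Category.assoc]
    refine (congrArg _ (congrArg _ hn.symm)).trans ?_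
    have hZ' := hZ =≫ (P.ι.commShiftIso n).inv.app (Y ⊗ Z)
    simp only [Category.assoc] at hZ'
    refine (congrArg _ hZ').trans ?_
    have hw' := hw =≫ (((tensorLeft Y.obj).commShiftIso n).hom.app Z.obj ≫
              (P.ι.commShiftIso n).inv.app (Y ⊗ Z))
    simp only [Category.assoc] at hw'
    exact hw'

end FullSubcategory

end TensorTriangulated

section Cellular

variable [SymmetricCategory C] [Preadditive C] [HasZeroObject C] [HasShift C ℤ]
  [∀ n : ℤ, (shiftFunctor C n).Additive] [Pretriangulated C] [IsTriangulated C]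
  [TensorTriangulated C]

/-- The full thick triangulated subcategory generated by the tensor powers `x^{⊗ n}`, `n ∈ ℤ`. -/
abbrev TensorPowers.cellular {x : C} (T : TensorPowers x) : ObjectProperty C :=
  (ObjectProperty.ofObj T.obj).triangEnvelope

namespace TensorPowers

variable {x : C} (T : TensorPowers x)

instance : (ObjectProperty.ofObj T.obj).Nonempty := ⟨⟨T.obj 0, ⟨0⟩⟩⟩

lemma cellular_obj (n : ℤ) : T.cellular (T.obj n) :=
  ObjectProperty.le_triangEnvelope _ _ ⟨n⟩

instance cellular_isMonoidal : T.cellular.IsMonoidal where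
  prop_unit := T.cellular.prop_of_iso T.zero.symm (T.cellular_obj 0)
  prop_tensor := by
    intro X Y hX hY
    have step (Z : C) (hZ : ∀ n, T.cellular (Z ⊗ T.obj n)) :
        T.cellular ≤ T.cellular.inverseImage (tensorLeft Z) := by
      have : (T.cellular.inverseImage (tensorLeft Z)).IsStableUnderRetracts :=
        ⟨fun r h => T.cellular.prop_of_retract (r.map (tensorLeft Z)) h⟩
      rw [ObjectProperty.triangEnvelope_le_iff]
      rintro _ ⟨n⟩
      exact hZ n
    have h1 (m : ℤ) : T.cellular (Y ⊗ T.obj m) :=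
      T.cellular.prop_of_iso (β_ _ _) (step (T.obj m) (fun n =>
        T.cellular.prop_of_iso (T.mulIso m n).symm (T.cellular_obj _)) _ hY)
    exact T.cellular.prop_of_iso (β_ _ _) (step Y h1 _ hX)

lemma cellular_self : T.cellular x :=
  T.cellular.prop_of_iso ((T.succ' 0 1 (by norm_num)).symm ≪≫
    whiskerRightIso T.zero.symm x ≪≫ λ_ x) (T.cellular_obj 1)

/-- The tensor powers of `x` in the cellular subcategory are those of the ambient category. -/
def restrict : TensorPowers (⟨x, T.cellular_self⟩ : T.cellular.FullSubcategory) where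
  obj n := ⟨T.obj n, T.cellular_obj n⟩
  zero := T.cellular.isoMk T.zero
  succ n := T.cellular.isoMk (T.succ n)

end TensorPowers

end Cellular

section Spectrum

variable (C) [SymmetricCategory C] [Preadditive C] [HasZeroObject C] [HasShift C ℤ]
  [∀ n : ℤ, (shiftFunctor C n).Additive] [Pretriangulated C]

/-- The spectrum `Spc C` of a tensor triangulated category: the set of prime tt-ideals, that is,
of proper thick triangulated `⊗`-ideals `P` such that `X ⊗ Y ∈ P` implies `X ∈ P` or `Y ∈ P`. -/
structure Spc where
  /-- membership in the prime -/
  prop : ObjectProperty C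
  isTriangulated : prop.IsTriangulated
  isThick : prop.IsStableUnderRetracts
  tensor_mem (X Y : C) : prop Y → prop (X ⊗ Y)
  ne_top : prop ≠ ⊤
  mem_or_mem (X Y : C) : prop (X ⊗ Y) → prop X ∨ prop Y

/-- The homogeneous spectrum `Spec^•` of a `ℤ`-graded ring: the set of homogeneous prime ideals.
A homogeneous ideal is given by its graded pieces. -/
structure HomogeneousSpec (A : ℤ → Type*) [∀ n, AddCommGroup (A n)] [DirectSum.GRing A] where
  /-- the degree `n` part of the ideal -/
  piece (n : ℤ) : AddSubgroup (A n)
  mul_mem_left {m n : ℤ} (a : A m) {b : A n} :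
    b ∈ piece n → GradedMonoid.GMul.mul a b ∈ piece (m + n)
  mul_mem_right {m n : ℤ} {a : A m} (b : A n) :
    a ∈ piece m → GradedMonoid.GMul.mul a b ∈ piece (m + n)
  one_notMem : GradedMonoid.GOne.one ∉ piece 0
  mem_or_mem {m n : ℤ} (a : A m) (b : A n) :
    GradedMonoid.GMul.mul a b ∈ piece (m + n) → a ∈ piece m ∨ b ∈ piece n

end Spectrum

section Comparison

variable [SymmetricCategory C]

/-- The action `X ≅ 𝟙 ⊗ X ⟶ w ⊗ X` of a morphism `a : 𝟙 ⟶ w` on an object `X`. -/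
def act {w : C} (a : 𝟙_ C ⟶ w) (X : C) : X ⟶ w ⊗ X := (λ_ X).inv ≫ a ▷ X

lemma act_naturality {w : C} (a : 𝟙_ C ⟶ w) {X Y : C} (φ : X ⟶ Y) :
    φ ≫ act a Y = act a X ≫ w ◁ φ := by
  simp [act, ← whisker_exchange]

lemma act_tensor {w : C} (a : 𝟙_ C ⟶ w) (X Y : C) :
    act a (X ⊗ Y) = act a X ▷ Y ≫ (α_ w X Y).hom := by
  simp [act]

lemma act_comp_act {w w' : C} (a : 𝟙_ C ⟶ w) (b : 𝟙_ C ⟶ w') (X : C) :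
    act (b ≫ act a w') X = act b X ≫ act a (w' ⊗ X) ≫ (α_ w w' X).inv := by
  simp [act]

lemma TensorPowers.mul_eq {x : C} (T : TensorPowers x) {m n : ℤ} (a : T.R m) (b : T.R n) :
    T.mul a b = (b ≫ act a (T.obj n)) ≫ (T.mulIso m n).hom := by
  simp [mul, act, tensorHom_def']

lemma scalar_comp {w : C} (σ : 𝟙_ C ⟶ 𝟙_ C) (f : 𝟙_ C ⟶ w) :
    σ ≫ f = f ≫ (λ_ w).inv ≫ σ ▷ w ≫ (λ_ w).hom := by
  have h : f ≫ (λ_ w).inv ≫ σ ▷ w = (λ_ _).inv ≫ σ ▷ 𝟙_ C ≫ 𝟙_ C ◁ f := by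
    rw [← whisker_exchange]; simp
  rw [reassoc_of% h]
  simp [unitors_inv_equal, unitors_equal]

/-- For a `⊗`-invertible object `w`, the symmetry of `w ⊗ w` is given by an endomorphism of `w`. -/
lemma exists_braiding_eq {w y : C} (e : w ⊗ y ≅ 𝟙_ C) : ∃ θ : w ⟶ w, (β_ w w).hom = θ ▷ w := by
  have := TensorPowers.isEquivalence_tensorRight e
  obtain ⟨θ, hθ⟩ := (tensorRight w).map_surjective (X := w) (Y := w) (β_ w w).hom
  exact ⟨θ, hθ.symm⟩

variable [Preadditive C] [HasZeroObject C] [HasShift C ℤ]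
  [∀ n : ℤ, (shiftFunctor C n).Additive] [Pretriangulated C] [TensorTriangulated C]

lemma act_add {w : C} (a b : 𝟙_ C ⟶ w) (X : C) : act (a + b) X = act a X + act b X := by
  simp [act]

open Pretriangulated

/-- A morphism `f : 𝟙 ⟶ w` with `w` invertible squares to zero on its cone. -/
lemma act_act_cone {w y : C} (e : w ⊗ y ≅ 𝟙_ C) (f : 𝟙_ C ⟶ w) {c : C} (g : w ⟶ c)
    (h : c ⟶ (𝟙_ C)⟦(1 : ℤ)⟧) (hT : Triangle.mk f g h ∈ distTriang C) :
    act f c ≫ act f (w ⊗ c) = 0 := by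
  obtain ⟨θ, hθ⟩ := exists_braiding_eq e
  have hfg : f ≫ g = 0 := comp_distTriang_mor_zero₁₂ _ hT
  have hhf : h ≫ f⟦(1 : ℤ)⟧' = 0 := comp_distTriang_mor_zero₃₁ _ hT
  have h1 : g ≫ act f c = 0 := by
    have h2 : f ▷ w = (β_ (𝟙_ C) w).hom ≫ w ◁ f ≫ θ ▷ w := by
      rw [← hθ, ← BraidedCategory.braiding_naturality_left_assoc]
      simp
    rw [act_naturality, act, h2]
    simp only [Category.assoc]
    rw [← whisker_exchange, ← MonoidalCategory.whiskerLeft_comp_assoc, hfg]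
    simp
  obtain ⟨k, hk⟩ : ∃ k : (𝟙_ C)⟦(1 : ℤ)⟧ ⟶ w ⊗ c, act f c = h ≫ k :=
    Triangle.yoneda_exact₃ _ hT (act f c) h1
  have h3 : h ≫ act f ((𝟙_ C)⟦(1 : ℤ)⟧) = 0 := by
    let cs (X : C) : X ⊗ (𝟙_ C)⟦(1 : ℤ)⟧ ≅ (X ⊗ 𝟙_ C)⟦(1 : ℤ)⟧ :=
      ((tensorLeft X).commShiftIso (1 : ℤ)).app (𝟙_ C)
    have hn : (cs (𝟙_ C)).hom ≫ (f ▷ 𝟙_ C)⟦(1 : ℤ)⟧' = f ▷ (𝟙_ C)⟦(1 : ℤ)⟧ ≫ (cs w).hom :=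
      NatTrans.shift_app_comm ((curriedTensor C).map f) (1 : ℤ) (𝟙_ C)
    obtain ⟨σ, hσ⟩ := (shiftFunctor C (1 : ℤ)).map_surjective
      ((λ_ _).inv ≫ (cs (𝟙_ C)).hom ≫ (ρ_ (𝟙_ C)).hom⟦(1 : ℤ)⟧')
    have h4 : act f ((𝟙_ C)⟦(1 : ℤ)⟧) ≫ (cs w).hom ≫ (ρ_ w).hom⟦(1 : ℤ)⟧' =
        f⟦(1 : ℤ)⟧' ≫ ((λ_ w).inv ≫ σ ▷ w ≫ (λ_ w).hom)⟦(1 : ℤ)⟧' := by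
      rw [← Functor.map_comp, ← scalar_comp, Functor.map_comp, hσ, act]
      simp only [Category.assoc]
      rw [← reassoc_of% hn, ← Functor.map_comp, ← Functor.map_comp, rightUnitor_naturality]
    rw [← cancel_mono ((cs w).hom ≫ (ρ_ w).hom⟦(1 : ℤ)⟧'), Category.assoc, h4,
      reassoc_of% hhf, zero_comp, zero_comp]
  rw [hk, Category.assoc, act_naturality, reassoc_of% h3, zero_comp]

lemma act_act_of_iso {w : C} (f : 𝟙_ C ⟶ w) {X Y : C} (e : X ≅ Y)
    (h : act f X ≫ act f (w ⊗ X) = 0) : act f Y ≫ act f (w ⊗ Y) = 0 := by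
  have : e.hom ≫ act f Y ≫ act f (w ⊗ Y) = 0 := by
    rw [reassoc_of% act_naturality, act_naturality, reassoc_of% h, zero_comp]
  rwa [← comp_zero (f := e.hom), cancel_epi] at this

lemma act_act_tensor {w : C} (f : 𝟙_ C ⟶ w) (X Y : C)
    (h : act f X ≫ act f (w ⊗ X) = 0) : act f (X ⊗ Y) ≫ act f (w ⊗ X ⊗ Y) = 0 := by
  rw [act_tensor, Category.assoc, act_naturality, act_tensor, Category.assoc,
    ← comp_whiskerRight_assoc, h]
  simp

namespace Spc

variable (P : Spc C)

attribute [instance] Spc.isTriangulated Spc.isThick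

lemma unit_notMem : ¬ P.prop (𝟙_ C) := fun h =>
  P.ne_top (top_le_iff.1 fun X _ => P.prop.prop_of_iso (ρ_ X) (P.tensor_mem X _ h))

lemma mem_of_trW_zero {X Y : C} {f : X ⟶ Y} (h : P.prop.trW f) (hf : f = 0) : P.prop X := by
  subst hf
  obtain ⟨Z, g, k, hT, hZ⟩ := (P.prop.trW_iff _).1 h
  obtain ⟨r, hr⟩ := Triangle.coyoneda_exact₁ _ hT (𝟙 (X⟦(1 : ℤ)⟧))
    (by exact (Category.id_comp _).trans (Functor.map_zero _ _ _))
  have : P.prop (X⟦(1 : ℤ)⟧) := P.prop.prop_of_retract ⟨r, k, hr.symm⟩ hZ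
  exact P.prop.prop_of_iso ((shiftEquiv C (1 : ℤ)).unitIso.symm.app X)
    (P.prop.le_shift (-1 : ℤ) _ this)

variable [IsTriangulated C]

lemma trW_act {w : C} {a : 𝟙_ C ⟶ w} (h : P.prop.trW a) (X : C) : P.prop.trW (act a X) := by
  obtain ⟨Z, g, k, hT, hZ⟩ := (P.prop.trW_iff _).1 h
  have h1 : P.prop.trW (X ◁ a) :=
    ObjectProperty.trW.mk _ ((tensorLeft X).map_distinguished _ hT) (P.tensor_mem X Z hZ)
  have h2 : act a X = (ρ_ X).inv ≫ X ◁ a ≫ (β_ X w).hom := by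
    rw [BraidedCategory.braiding_naturality_right]
    simp [act]
  rw [h2]
  exact P.prop.trW.comp_mem _ _ (P.prop.trW_of_isIso _)
    (P.prop.trW.comp_mem _ _ h1 (P.prop.trW_of_isIso _))

lemma not_trW_add {w y : C} (e : w ⊗ y ≅ 𝟙_ C) {f g : 𝟙_ C ⟶ w} (hf : ¬ P.prop.trW f)
    (hg : ¬ P.prop.trW g) : ¬ P.prop.trW (f + g) := by
  intro h
  obtain ⟨cf, f₂, f₃, hTf⟩ := distinguished_cocone_triangle f
  obtain ⟨cg, g₂, g₃, hTg⟩ := distinguished_cocone_triangle g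
  have F := act_act_tensor f cf cg (act_act_cone e f f₂ f₃ hTf)
  have G := act_act_of_iso g (β_ cg cf) (act_act_tensor g cg cf (act_act_cone e g g₂ g₃ hTg))
  set c := cf ⊗ cg
  have hz : act (f + g) c ≫ act (f + g) (w ⊗ c) ≫ act (f + g) (w ⊗ w ⊗ c) = 0 := by
    have key (a b : 𝟙_ C ⟶ w) (ha : act a c ≫ act a (w ⊗ c) = 0) :
        act a c ≫ act b (w ⊗ c) ≫ act a (w ⊗ w ⊗ c) = 0 ∧
          act b c ≫ act a (w ⊗ c) ≫ act a (w ⊗ w ⊗ c) = 0 := by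
      constructor
      · rw [act_naturality, reassoc_of% ha, zero_comp]
      · rw [reassoc_of% act_naturality, act_naturality, reassoc_of% ha, zero_comp]
    simp only [act_add, Preadditive.add_comp, Preadditive.comp_add, (key f g F).1, (key f g F).2,
      (key g f G).1, (key g f G).2, reassoc_of% F, reassoc_of% G, zero_comp, add_zero]
  have hc : P.prop c := P.mem_of_trW_zero (P.prop.trW.comp_mem _ _ (P.trW_act h _)
    (P.prop.trW.comp_mem _ _ (P.trW_act h _) (P.trW_act h _))) hz
  rcases P.mem_or_mem _ _ hc with hc | hc
  · exact hf (ObjectProperty.trW.mk _ hTf hc)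
  · exact hg (ObjectProperty.trW.mk _ hTg hc)

lemma not_trW_left {w y w' : C} (e : w ⊗ y ≅ 𝟙_ C) {a : 𝟙_ C ⟶ w} (ha : ¬ P.prop.trW a)
    (b : 𝟙_ C ⟶ w') : ¬ P.prop.trW (b ≫ act a w') := by
  intro h
  obtain ⟨c, a₂, a₃, hT⟩ := distinguished_cocone_triangle a
  have A := act_act_cone e a a₂ a₃ hT
  have hz : act (b ≫ act a w') c ≫ act (b ≫ act a w') ((w ⊗ w') ⊗ c) = 0 := by
    have A' : act b c ≫ act a (w' ⊗ c) ≫ act a (w ⊗ w' ⊗ c) = 0 := by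
      rw [reassoc_of% act_naturality, act_naturality, reassoc_of% A, zero_comp]
    have h2 := act_naturality a ((α_ w w' c).inv ≫ act b ((w ⊗ w') ⊗ c))
    simp only [Category.assoc] at h2
    rw [act_comp_act, act_comp_act]
    simp only [Category.assoc]
    rw [reassoc_of% h2, reassoc_of% A', zero_comp]
  exact ha (ObjectProperty.trW.mk _ hT (P.mem_of_trW_zero
    (P.prop.trW.comp_mem _ _ (P.trW_act h _) (P.trW_act h _)) hz))

lemma not_trW_right {w w' y : C} (e : w' ⊗ y ≅ 𝟙_ C) (a : 𝟙_ C ⟶ w) {b : 𝟙_ C ⟶ w'}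
    (hb : ¬ P.prop.trW b) : ¬ P.prop.trW (b ≫ act a w') := by
  intro h
  obtain ⟨c, b₂, b₃, hT⟩ := distinguished_cocone_triangle b
  have B := act_act_cone e b b₂ b₃ hT
  have hz : act (b ≫ act a w') c ≫ act (b ≫ act a w') ((w ⊗ w') ⊗ c) = 0 := by
    have h2 := act_naturality b (act a (w' ⊗ c) ≫ (α_ w w' c).inv)
    simp only [Category.assoc] at h2
    rw [act_comp_act, act_comp_act]
    simp only [Category.assoc]
    rw [reassoc_of% h2, reassoc_of% B, zero_comp]
  exact hb (ObjectProperty.trW.mk _ hT (P.mem_of_trW_zero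
    (P.prop.trW.comp_mem _ _ (P.trW_act h _) (P.trW_act h _)) hz))

end Spc

variable [IsTriangulated C]

/-- `x^{⊗ n}` is `⊗`-invertible. -/
def TensorPowers.invIso {x : C} (T : TensorPowers x) (n : ℤ) : T.obj n ⊗ T.obj (-n) ≅ 𝟙_ C :=
  T.mulIso n (-n) ≪≫ T.cast (by simp) ≪≫ T.zero.symm

/-- The comparison map `ρ : Spc C → Spec^•(Hom(𝟙, x^{⊗ •}))`, which sends a prime `P` to
`{f | cone(f) ∉ P}`. Here `P.prop.trW f` says that the cone of `f` is in `P`. -/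
def comparisonMap {x : C} (T : TensorPowers x) (P : Spc C) : HomogeneousSpec T.R where
  piece n :=
    { carrier := {f | ¬ P.prop.trW f}
      zero_mem' := fun h => P.unit_notMem (P.mem_of_trW_zero h rfl)
      add_mem' := fun hf hg => P.not_trW_add (T.invIso n) hf hg
      neg_mem' := fun {f} hf h => hf (by
        have := P.prop.trW.comp_mem _ (-𝟙 (T.obj n)) h
          (by
            have : IsIso (-𝟙 (T.obj n)) := ⟨-𝟙 _, by simp, by simp⟩
            exact P.prop.trW_of_isIso _)
        simpa using this) }
  mul_mem_left {m n} a b hb h := by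
    change P.prop.trW (T.mul a b) at h
    rw [T.mul_eq, P.prop.trW.cancel_right_of_respectsIso] at h
    exact P.not_trW_right (T.invIso n) a hb h
  mul_mem_right {m n} a b ha h := by
    change P.prop.trW (T.mul a b) at h
    rw [T.mul_eq, P.prop.trW.cancel_right_of_respectsIso] at h
    exact P.not_trW_left (T.invIso m) ha b h
  one_notMem h := h (P.prop.trW_of_isIso T.zero.hom)
  mem_or_mem {m n} a b h := by
    by_contra! hab
    refine h ?_
    change P.prop.trW (T.mul a b)
    rw [T.mul_eq]
    exact P.prop.trW.comp_mem _ _ (P.prop.trW.comp_mem _ _ (not_not.1 hab.2)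
      (P.trW_act (not_not.1 hab.1) _)) (P.prop.trW_of_isIso _)

end Comparison

section Statement

/-- A symmetric monoidal category is rigid if every object `X` has a dual `Y`: there are
`η : 𝟙 ⟶ Y ⊗ X` and `ε : X ⊗ Y ⟶ 𝟙` satisfying the triangle identities. -/
def IsRigid (D : Type*) [Category D] [MonoidalCategory D] : Prop :=
  ∀ X : D, ∃ Y : D, Nonempty (ExactPairing Y X)

variable [SymmetricCategory C] [Preadditive C] [HasZeroObject C] [HasShift C ℤ]
  [∀ n : ℤ, (shiftFunctor C n).Additive] [Pretriangulated C] [IsTriangulated C]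
  [TensorTriangulated C]

/-- The map `Spc C → Spc K`, `Q ↦ Q ∩ K`, for a full tensor triangulated subcategory `K`. -/
def Spc.restrict (K : ObjectProperty C) [K.IsMonoidal] [K.IsTriangulated] (Q : Spc C) :
    Spc K.FullSubcategory where
  prop := Q.prop.inverseImage K.ι
  isTriangulated := inferInstance
  isThick := ⟨fun r h => Q.prop.prop_of_retract (r.map K.ι) h⟩
  tensor_mem X Y h := Q.tensor_mem X.obj Y.obj h
  ne_top h := Q.unit_notMem
    (show Q.prop.inverseImage K.ι (𝟙_ K.FullSubcategory) by rw [h]; trivial)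
  mem_or_mem X Y h := Q.mem_or_mem X.obj Y.obj h

/-- The map `Hom_K(𝟙, x^{⊗ n}) → Hom_C(𝟙, x^{⊗ n})` given by the inclusion of the cellular
subcategory `K` in `C`. -/
def TensorPowers.inclusion {x : C} (T : TensorPowers x) {n : ℤ} (f : T.restrict.R n) : T.R n :=
  T.cellular.ι.map f

end Statement

end

end TTGeometry

open TTGeometry

/- The comparison map of `K` is the restriction of that of `L`, so everything rests on lifting a
prime `P` of `K` to `L`. Consider the objects of `L` annihilated by some `ξ : w ⟶ 𝟙` in `K` whose
cone lies in `P`. They form a tt-ideal of `L`: if `ξ` annihilates `X` and `ζ` annihilates `Z`, then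
`ζ ⊗ ξ` annihilates every extension of `Z` by `X`. An object of `K` annihilated by `ξ` is a direct
summand of its tensor product with the cone of `ξ`, hence lies in `P`; conversely, if `X ∈ P` has
dual `Y`, then the fibre of the coevaluation `𝟙 ⟶ Y ⊗ X` annihilates `X` by a triangle identity.
So this tt-ideal meets `K` exactly in `P`, and Zorn's lemma enlarges it to a prime of `L` that
avoids the `⊗`-multiplicative class `K ∖ P`. -/

namespace TTGeometry

open Pretriangulated

variable {C : Type u} [Category.{v} C]

section Ideals

lemma isStableUnderRetracts_iSup {ι : Type*} (P : ι → ObjectProperty C)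
    [∀ i, (P i).IsStableUnderRetracts] : (⨆ i, P i).IsStableUnderRetracts where
  of_retract r h := by
    rw [ObjectProperty.prop_iSup_iff] at h ⊢
    exact h.imp fun i hi => (P i).prop_of_retract r hi

lemma isStableUnderShift_iSup {ι A : Type*} [AddMonoid A] [HasShift C A] (P : ι → ObjectProperty C)
    [∀ i, (P i).IsStableUnderShift A] : (⨆ i, P i).IsStableUnderShift A where
  isStableUnderShiftBy n := ⟨fun X h => by
    rw [ObjectProperty.prop_iSup_iff] at h
    obtain ⟨i, hi⟩ := h
    exact le_iSup P i _ ((P i).le_shift n X hi)⟩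

variable [Preadditive C] [HasZeroObject C] [HasShift C ℤ]
  [∀ n : ℤ, (shiftFunctor C n).Additive] [Pretriangulated C]

lemma isTriangulated_iSup {ι : Type*} [Nonempty ι] {P : ι → ObjectProperty C}
    (hP : Directed (· ≤ ·) P) [∀ i, (P i).IsTriangulated] : (⨆ i, P i).IsTriangulated where
  exists_zero := by
    obtain ⟨i⟩ := ‹Nonempty ι›
    obtain ⟨Z, hZ, hPZ⟩ := (P i).exists_prop_of_containsZero
    exact ⟨Z, hZ, le_iSup P i Z hPZ⟩
  toIsStableUnderShift := isStableUnderShift_iSup P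
  ext₂' T hT h₁ h₃ := by
    rw [ObjectProperty.prop_iSup_iff] at h₁ h₃
    obtain ⟨i, hi⟩ := h₁
    obtain ⟨j, hj⟩ := h₃
    obtain ⟨k, hik, hjk⟩ := hP i j
    exact ObjectProperty.monotone_isoClosure (le_iSup P k) _
      ((P k).ext_of_isTriangulatedClosed₂' T hT (hik _ hi) (hjk _ hj))

lemma prop_tgt_of_trW_zero {P : ObjectProperty C} [P.IsStableUnderRetracts] {X Y : C}
    (h : P.trW (0 : X ⟶ Y)) : P Y := by
  obtain ⟨Z, g, k, hT, hZ⟩ := (P.trW_iff _).1 h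
  obtain ⟨r, hr⟩ := Triangle.yoneda_exact₂ _ hT (𝟙 Y) zero_comp
  exact P.prop_of_retract ⟨g, r, hr.symm⟩ hZ

variable [MonoidalCategory C]

/-- The tt-ideals of a tensor triangulated category: the thick triangulated subcategories that are
closed under tensoring on the left with arbitrary objects. -/
class IsTTIdeal (P : ObjectProperty C) : Prop extends P.IsTriangulated,
    P.IsStableUnderRetracts where
  tensor_mem (X : C) {Y : C} : P Y → P (X ⊗ Y)

namespace IsTTIdeal

lemma iSup {ι : Type*} [Nonempty ι] {P : ι → ObjectProperty C} (hP : Directed (· ≤ ·) P)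
    [∀ i, IsTTIdeal (P i)] : IsTTIdeal (⨆ i, P i) where
  __ := isTriangulated_iSup hP
  __ := isStableUnderRetracts_iSup P
  tensor_mem X Y h := by
    rw [ObjectProperty.prop_iSup_iff] at h ⊢
    exact h.imp fun i hi => tensor_mem X hi

lemma exists_le_maximal_le_compl {J S : ObjectProperty C} [hJ : IsTTIdeal J] (hJS : S ≤ Jᶜ) :
    ∃ Q, J ≤ Q ∧ Maximal (fun Q => IsTTIdeal Q ∧ S ≤ Qᶜ) Q := by
  refine zorn_le_nonempty₀ {Q | IsTTIdeal Q ∧ S ≤ Qᶜ} (fun c hcs hc P₀ hP₀ => ?_) J ⟨hJ, hJS⟩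
  have : Nonempty c := ⟨⟨P₀, hP₀⟩⟩
  have (P : c) : IsTTIdeal P.1 := (hcs P.2).1
  refine ⟨⨆ P : c, P.1, ⟨iSup hc.directed, fun X hX h => ?_⟩,
    fun P hP => le_iSup (fun P : c => P.1) ⟨P, hP⟩⟩
  obtain ⟨P, hPX⟩ := (ObjectProperty.prop_iSup_iff _ _).1 h
  exact (hcs P.2).2 X hX hPX

end IsTTIdeal

end Ideals

section Annihilation

variable [MonoidalCategory C]

lemma whiskerLeft_eq_zero_iff [HasZeroMorphisms C] [BraidedCategory C] {X Y Z : C} (f : X ⟶ Y) :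
    Z ◁ f = 0 ↔ f ▷ Z = 0 := by
  rw [← cancel_mono (β_ Z Y).hom, BraidedCategory.braiding_naturality_right, zero_comp,
    ← comp_zero (f := (β_ Z X).hom), cancel_epi]

lemma whiskerLeft_eq_zero_of_retract [HasZeroMorphisms C] {X X' Y Z : C} (r : Retract X X')
    {f : Y ⟶ Z} (h : X' ◁ f = 0) : X ◁ f = 0 := by
  have hr : X ◁ f = r.i ▷ Y ≫ X' ◁ f ≫ r.r ▷ Z := by
    rw [whisker_exchange, ← comp_whiskerRight_assoc, r.retract]
    simp
  rw [hr, h, zero_comp, comp_zero]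

lemma whiskerLeft_tensor_eq_zero [Preadditive C] [MonoidalPreadditive C] (X : C) {X' Y Z : C}
    {f : Y ⟶ Z} (h : X' ◁ f = 0) : (X ⊗ X') ◁ f = 0 := by
  rw [tensor_whiskerLeft, h, MonoidalPreadditive.whiskerLeft_zero, zero_comp, comp_zero]

/-- A triangle identity exhibits `X ◁ η_ Y X` as a split monomorphism. -/
lemma whiskerLeft_eq_zero_of_comp_coevaluation [Preadditive C] [MonoidalPreadditive C]
    {X Y w : C} [ExactPairing Y X] {ξ : w ⟶ 𝟙_ C} (h : ξ ≫ η_ Y X = 0) : X ◁ ξ = 0 := by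
  have hη : X ◁ ξ ≫ X ◁ η_ Y X = 0 := by
    rw [← MonoidalCategory.whiskerLeft_comp, h, MonoidalPreadditive.whiskerLeft_zero]
  have hζ := X ◁ ξ ≫= ExactPairing.coevaluation_evaluation Y X
  rw [reassoc_of% hη, zero_comp] at hζ
  rw [← cancel_mono ((ρ_ X).hom ≫ (λ_ X).inv), ← hζ, zero_comp]

variable [Preadditive C] [HasZeroObject C] [HasShift C ℤ]
  [∀ n : ℤ, (shiftFunctor C n).Additive] [Pretriangulated C]

lemma whiskerLeft_obj₂_eq_zero {T : Triangle C} (hT : T ∈ distTriang C) {w w' : C}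
    {ξ : w ⟶ 𝟙_ C} {ζ : w' ⟶ 𝟙_ C} (h₁ : T.obj₁ ◁ ξ = 0) (h₃ : T.obj₃ ◁ ζ = 0) :
    T.obj₂ ◁ (w' ◁ ξ ≫ (ρ_ w').hom ≫ ζ) = 0 := by
  have hζ : (T.obj₂ ◁ ζ ≫ (ρ_ T.obj₂).hom) ≫ T.mor₂ = 0 := by
    rw [Category.assoc, ← rightUnitor_naturality, whisker_exchange_assoc, h₃, zero_comp, comp_zero]
  obtain ⟨k, hk⟩ := Triangle.coyoneda_exact₂ T hT _ hζ
  calc T.obj₂ ◁ (w' ◁ ξ ≫ (ρ_ w').hom ≫ ζ)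
      = (α_ _ _ _).inv ≫ (T.obj₂ ⊗ w') ◁ ξ ≫ (T.obj₂ ◁ ζ ≫ (ρ_ T.obj₂).hom) ▷ 𝟙_ C ≫
          (ρ_ T.obj₂).hom ≫ (ρ_ T.obj₂).inv := by simp
    _ = (α_ _ _ _).inv ≫ k ▷ w ≫ T.obj₁ ◁ ξ ≫ T.mor₁ ▷ 𝟙_ C ≫
          (ρ_ T.obj₂).hom ≫ (ρ_ T.obj₂).inv := by
      rw [hk, comp_whiskerRight_assoc, whisker_exchange_assoc]
    _ = 0 := by rw [h₁, zero_comp, comp_zero, comp_zero]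

variable [SymmetricCategory C] [TensorTriangulated C]

lemma whiskerLeft_shift_eq_zero {X Y Z : C} {f : Y ⟶ Z} (h : X ◁ f = 0) (n : ℤ) :
    X⟦n⟧ ◁ f = 0 := by
  rw [whiskerLeft_eq_zero_iff] at h ⊢
  have hn := NatTrans.shift_app_comm ((curriedTensor C).map f) n X
  dsimp only [curriedTensor_map_app] at hn
  rw [h, Functor.map_zero, comp_zero] at hn
  rw [← cancel_mono (((tensorLeft Z).commShiftIso n).hom.app X), zero_comp]
  exact hn.symm

end Annihilation

section Primes

variable [MonoidalCategory C] [Preadditive C] [HasZeroObject C] [HasShift C ℤ]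
  [∀ n : ℤ, (shiftFunctor C n).Additive] [Pretriangulated C]

@[ext]
lemma Spc.ext {P Q : Spc C} (h : P.prop = Q.prop) : P = Q := by
  cases P
  cases Q
  congr

instance (P : Spc C) : IsTTIdeal P.prop where
  tensor_mem X _ := P.tensor_mem X _

variable [TensorTriangulated C]

lemma IsTTIdeal.trW_whiskerLeft {P : ObjectProperty C} [IsTTIdeal P] {X Y : C} {f : X ⟶ Y}
    (hf : P.trW f) (Z : C) : P.trW (Z ◁ f) := by
  obtain ⟨W, g, k, hT, hW⟩ := (P.trW_iff _).1 hf
  exact ObjectProperty.trW.mk _ ((tensorLeft Z).map_distinguished _ hT) (tensor_mem Z hW)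

variable [SymmetricCategory C]

instance (P : Spc C) : P.propᶜ.IsMonoidal where
  prop_unit := P.unit_notMem
  prop_tensor X Y hX hY h := (P.mem_or_mem X Y h).elim hX hY

namespace IsTTIdeal

instance quotient (P : ObjectProperty C) [IsTTIdeal P] (Y : C) :
    IsTTIdeal (P.inverseImage (tensorLeft Y)) where
  of_retract r h := P.prop_of_retract (r.map (tensorLeft Y)) h
  tensor_mem X Z h := P.prop_of_iso
    ((α_ X Y Z).symm ≪≫ whiskerRightIso (β_ X Y) Z ≪≫ α_ Y X Z) (tensor_mem X h)

lemma exists_tensor_mem_of_maximal {Q S : ObjectProperty C}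
    (hQ : Maximal (fun Q => IsTTIdeal Q ∧ S ≤ Qᶜ) Q) {X Y : C} (hXY : Q (X ⊗ Y)) (hY : ¬ Q Y) :
    ∃ s, S s ∧ Q (X ⊗ s) := by
  have := hQ.prop.1
  by_contra! h
  exact hY (hQ.le_of_ge (y := Q.inverseImage (tensorLeft X)) ⟨inferInstance, h⟩
    (fun _ hZ => tensor_mem X hZ) Y hXY)

lemma mem_or_mem_of_maximal {Q S : ObjectProperty C} [S.IsMonoidal]
    (hQ : Maximal (fun Q => IsTTIdeal Q ∧ S ≤ Qᶜ) Q) {X Y : C} (hXY : Q (X ⊗ Y)) :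
    Q X ∨ Q Y := by
  have := hQ.prop.1
  by_contra! h
  obtain ⟨s, hs, hXs⟩ := exists_tensor_mem_of_maximal hQ hXY h.2
  obtain ⟨t, ht, hst⟩ := exists_tensor_mem_of_maximal hQ (Q.prop_of_iso (β_ X s) hXs) h.1
  exact hQ.prop.2 _ (S.prop_tensor hs ht) hst

end IsTTIdeal

theorem Spc.exists_le_prop_le_compl {J S : ObjectProperty C} [IsTTIdeal J] [S.IsMonoidal]
    (hJS : S ≤ Jᶜ) : ∃ Q : Spc C, J ≤ Q.prop ∧ S ≤ Q.propᶜ := by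
  obtain ⟨Q, hJQ, hQ⟩ := IsTTIdeal.exists_le_maximal_le_compl hJS
  have := hQ.prop.1
  exact ⟨{
    prop := Q
    isTriangulated := inferInstance
    isThick := inferInstance
    tensor_mem X _ := IsTTIdeal.tensor_mem X
    ne_top h := hQ.prop.2 _ S.prop_unit (h ▸ trivial)
    mem_or_mem _ _ := IsTTIdeal.mem_or_mem_of_maximal hQ }, hJQ, hQ.prop.2⟩

end Primes

section Extension

variable [MonoidalCategory C] {K : ObjectProperty C} [K.IsMonoidal]

instance (S : ObjectProperty K.FullSubcategory) [S.IsMonoidal] :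
    (S.strictMap K.ι).IsMonoidal where
  prop_unit := ⟨𝟙_ K.FullSubcategory, S.prop_unit⟩
  prop_tensor := by
    rintro _ _ ⟨X, hX⟩ ⟨Y, hY⟩
    exact ⟨X ⊗ Y, S.prop_tensor hX hY⟩

variable [Preadditive C] [HasZeroObject C] [HasShift C ℤ]
  [∀ n : ℤ, (shiftFunctor C n).Additive] [Pretriangulated C] [K.IsTriangulated]

/-- The extension to `C` of a tt-ideal `J` of a full subcategory `K`: the objects of `C` that are
annihilated by a morphism `ξ : w ⟶ 𝟙` of `K` whose cone is in `J`. This explicit form, rather than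
the tt-ideal of `C` generated by `J`, makes the intersection with `K` computable. -/
def idealExtension (J : ObjectProperty K.FullSubcategory) : ObjectProperty C := fun X =>
  ∃ (w : K.FullSubcategory) (ξ : w ⟶ 𝟙_ K.FullSubcategory), J.trW ξ ∧ X ◁ ξ.hom = 0

instance (J : ObjectProperty K.FullSubcategory) : (idealExtension J).IsStableUnderRetracts where
  of_retract r := fun ⟨w, ξ, hξ, h⟩ => ⟨w, ξ, hξ, whiskerLeft_eq_zero_of_retract r h⟩

variable [TensorTriangulated C] {J : ObjectProperty K.FullSubcategory} [IsTTIdeal J]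

lemma prop_of_idealExtension {X : K.FullSubcategory} (h : idealExtension J X.obj) : J X := by
  obtain ⟨w, ξ, hξ, h⟩ := h
  have hX : X ◁ ξ = 0 := by
    ext
    exact h
  exact J.prop_of_iso (ρ_ X) (prop_tgt_of_trW_zero (hX ▸ IsTTIdeal.trW_whiskerLeft hξ X))

variable [SymmetricCategory C]

lemma idealExtension_of_exactPairing {X Y : K.FullSubcategory} [ExactPairing Y X] (h : J X) :
    idealExtension J X.obj := by
  obtain ⟨w, ξ, k, hT⟩ := distinguished_cocone_triangle₁ (η_ Y X)
  have hξ : X ◁ ξ = 0 :=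
    whiskerLeft_eq_zero_of_comp_coevaluation (comp_distTriang_mor_zero₁₂ _ hT)
  exact ⟨w, ξ, ObjectProperty.trW.mk _ hT (IsTTIdeal.tensor_mem Y h),
    congrArg (fun f => f.hom) hξ⟩

lemma idealExtension_inverseImage_ι (hK : IsRigid K.FullSubcategory) :
    (idealExtension J).inverseImage K.ι = J := by
  ext X
  obtain ⟨Y, ⟨_⟩⟩ := hK X
  exact ⟨prop_of_idealExtension, idealExtension_of_exactPairing (Y := Y)⟩

variable [IsTriangulated C]

variable (J) in
instance isTTIdeal_idealExtension : IsTTIdeal (idealExtension J) where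
  exists_zero := ⟨_, isZero_zero C, 𝟙_ _, 𝟙 _, J.trW_of_isIso _,
    ((tensorRight _).map_isZero (isZero_zero C)).eq_of_src _ _⟩
  isStableUnderShiftBy n := ⟨fun _ ⟨w, ξ, hξ, h⟩ => ⟨w, ξ, hξ, whiskerLeft_shift_eq_zero h n⟩⟩
  toIsTriangulatedClosed₂ := .mk' fun _ hT ⟨w, ξ, hξ, h₁⟩ ⟨w', ζ, hζ, h₃⟩ =>
    ⟨w' ⊗ w, w' ◁ ξ ≫ (ρ_ w').hom ≫ ζ,
      J.trW.comp_mem _ _ (IsTTIdeal.trW_whiskerLeft hξ w')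
        (J.trW.comp_mem _ _ (J.trW_of_isIso _) hζ),
      whiskerLeft_obj₂_eq_zero hT h₁ h₃⟩
  tensor_mem X _ := fun ⟨w, ξ, hξ, h⟩ => ⟨w, ξ, hξ, whiskerLeft_tensor_eq_zero X h⟩

theorem Spc.restrict_surjective (hK : IsRigid K.FullSubcategory) :
    Function.Surjective (Spc.restrict (C := C) K) := by
  intro P
  have hι := idealExtension_inverseImage_ι (J := P.prop) hK
  have hdisj : P.propᶜ.strictMap K.ι ≤ (idealExtension P.prop)ᶜ := by
    rintro _ ⟨X, hX⟩ h
    exact hX (hι.le X h)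
  obtain ⟨Q, hPQ, hQ⟩ := Spc.exists_le_prop_le_compl hdisj
  refine ⟨Q, Spc.ext (le_antisymm (fun X hX => ?_) (fun X hX => ?_))⟩
  · by_contra hPX
    exact hQ _ ⟨X, hPX⟩ hX
  · exact hPQ _ (hι.ge X hX)

end Extension

section GradedRings

/-- A homomorphism of graded rings, for rings graded externally by a family of additive monoids. -/
structure GRingHom {ι : Type*} [AddMonoid ι] (A B : ι → Type*) [∀ i, AddCommMonoid (A i)]
    [∀ i, AddCommMonoid (B i)] [DirectSum.GSemiring A] [DirectSum.GSemiring B] where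
  hom (i : ι) : A i →+ B i
  map_one : hom 0 GradedMonoid.GOne.one = GradedMonoid.GOne.one
  map_mul {i j : ι} (a : A i) (b : A j) :
    hom (i + j) (GradedMonoid.GMul.mul a b) = GradedMonoid.GMul.mul (hom i a) (hom j b)

namespace HomogeneousSpec

variable {A B : ℤ → Type*} [∀ n, AddCommGroup (A n)] [∀ n, AddCommGroup (B n)]
  [DirectSum.GRing A] [DirectSum.GRing B]

@[ext]
lemma ext {p q : HomogeneousSpec A} (h : ∀ n, p.piece n = q.piece n) : p = q := by
  cases p
  cases q
  congr
  exact funext h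

/-- The map `Spec^•(B) → Spec^•(A)` induced by a homomorphism of graded rings `A → B`. -/
def comap (φ : GRingHom A B) (p : HomogeneousSpec B) : HomogeneousSpec A where
  piece n := (p.piece n).comap (φ.hom n)
  mul_mem_left a _ hb := by
    rw [AddSubgroup.mem_comap, φ.map_mul]
    exact p.mul_mem_left _ hb
  mul_mem_right b ha := by
    rw [AddSubgroup.mem_comap, φ.map_mul]
    exact p.mul_mem_right _ ha
  one_notMem := by
    rw [AddSubgroup.mem_comap, φ.map_one]
    exact p.one_notMem
  mem_or_mem a b h := by
    rw [AddSubgroup.mem_comap, φ.map_mul] at h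
    exact p.mem_or_mem _ _ h

lemma comap_injective {φ : GRingHom A B} (hφ : ∀ n, Function.Surjective (φ.hom n)) :
    Function.Injective (comap φ) := fun _ _ h =>
  ext fun n => AddSubgroup.comap_injective (hφ n) (congrArg (fun p => p.piece n) h)

end HomogeneousSpec

end GradedRings

namespace TensorPowers

variable [MonoidalCategory C] [SymmetricCategory C] [Preadditive C] [HasZeroObject C]
  [HasShift C ℤ] [∀ n : ℤ, (shiftFunctor C n).Additive] [Pretriangulated C] [IsTriangulated C]
  [TensorTriangulated C] {x : C} (T : TensorPowers x)

lemma restrict_cast_hom {a b : ℤ} (h : a = b) :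
    (T.restrict.cast h).hom.hom = (T.cast h).hom := by
  subst h
  rfl

lemma restrict_succ'_hom {a b : ℤ} (h : a + 1 = b) :
    (T.restrict.succ' a b h).hom.hom = (T.succ' a b h).hom := by
  subst h
  rfl

lemma restrict_mulIso_hom (m n : ℤ) :
    (T.restrict.mulIso m n).hom.hom = (T.mulIso m n).hom := by
  refine T.eq_of_mulRel (fun n => (T.restrict.mulIso m n).hom.hom)
    (fun n => (T.mulIso m n).hom) (fun a => ?_) (fun a => T.mulIso_rel m rfl) ?_ n
  · have h := congrArg InducedCategory.Hom.hom (T.restrict.mulIso_rel m (a := a) rfl)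
    dsimp only [ObjectProperty.tensorObj_obj, ObjectProperty.whiskerRight_def,
      ObjectProperty.FullSubcategory.comp_hom, ObjectProperty.homMk_hom,
      ObjectProperty.associator_def, ObjectProperty.whiskerLeft_def] at h
    rwa [restrict_succ'_hom, restrict_succ'_hom] at h
  · have h := congrArg InducedCategory.Hom.hom (T.restrict.mulIso_zero m)
    refine h.trans (Eq.trans ?_ (T.mulIso_zero m).symm)
    exact congrArg (fun f => T.obj m ◁ T.zero.inv ≫ (ρ_ _).hom ≫ f) (T.restrict_cast_hom _)

/-- The inclusion of the cellular subcategory, as a homomorphism of graded rings. -/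
def inclusionHom : GRingHom T.restrict.R T.R where
  hom n := AddMonoidHom.mk' (T.inclusion (n := n)) fun _ _ => rfl
  map_one := rfl
  map_mul {m n} f g :=
    congrArg (fun h => (λ_ (𝟙_ C)).inv ≫ (f.hom ⊗ₘ g.hom) ≫ h) (T.restrict_mulIso_hom m n)

lemma inclusion_bijective (n : ℤ) : Function.Bijective (T.inclusion (n := n)) :=
  ⟨T.cellular.ι.map_injective, T.cellular.ι.map_surjective⟩

lemma comparisonMap_restrict (Q : Spc C) :
    comparisonMap T.restrict (Q.restrict T.cellular) =
      (comparisonMap T Q).comap T.inclusionHom := by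
  ext n f
  exact not_congr (Q.prop.inverseImage_trW_iff T.cellular.ι f)

lemma comparisonMap_surjective_of_restrict
    (hT : Function.Surjective (Spc.restrict (C := C) T.cellular))
    (hρ : Function.Surjective (comparisonMap T.restrict)) :
    Function.Surjective (comparisonMap T) := by
  have hcomp : HomogeneousSpec.comap T.inclusionHom ∘ comparisonMap T =
      comparisonMap T.restrict ∘ Spc.restrict T.cellular :=
    funext fun Q => (T.comparisonMap_restrict Q).symm
  exact (hcomp ▸ hρ.comp hT : Function.Surjective (_ ∘ _)).of_comp_left
    (HomogeneousSpec.comap_injective fun n => (T.inclusion_bijective n).surjective)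

end TensorPowers

end TTGeometry

theorem corollary1p8 {L : Type u} [Category.{v} L] [MonoidalCategory L] [SymmetricCategory L]
    [Preadditive L] [HasZeroObject L] [HasShift L ℤ] [∀ n : ℤ, (shiftFunctor L n).Additive]
    [Pretriangulated L] [IsTriangulated L] [TensorTriangulated L]
    (u : L) (hu : IsTensorInvertible u)
    (hK : IsRigid hu.powers.cellular.FullSubcategory) :
    -- the inclusion is an isomorphism of graded rings
    ((∀ n : ℤ, Function.Bijective (hu.powers.inclusion (n := n))) ∧
      (∀ (n : ℤ) (f g : hu.powers.restrict.R n),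
        hu.powers.inclusion (f + g) = hu.powers.inclusion f + hu.powers.inclusion g) ∧
      hu.powers.inclusion (GradedMonoid.GOne.one : hu.powers.restrict.R 0) =
        GradedMonoid.GOne.one ∧
      (∀ (m n : ℤ) (f : hu.powers.restrict.R m) (g : hu.powers.restrict.R n),
        hu.powers.inclusion (GradedMonoid.GMul.mul f g : hu.powers.restrict.R (m + n)) =
          GradedMonoid.GMul.mul (hu.powers.inclusion f) (hu.powers.inclusion g))) ∧
    -- the square of comparison maps commutes, and its top map is surjective
    (∀ (Q : Spc L) (n : ℤ) (f : hu.powers.restrict.R n),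
      f ∈ (comparisonMap hu.powers.restrict (Q.restrict hu.powers.cellular)).piece n ↔
        hu.powers.inclusion f ∈ (comparisonMap hu.powers Q).piece n) ∧
    Function.Surjective (Spc.restrict (C := L) hu.powers.cellular) ∧
    -- surjectivity can be tested on the cellular subcategory
    (Function.Surjective (comparisonMap hu.powers.restrict) →
      Function.Surjective (comparisonMap hu.powers)) := by
  have hrestrict := Spc.restrict_surjective hK
  refine ⟨⟨hu.powers.inclusion_bijective, fun n => map_add (hu.powers.inclusionHom.hom n),
    hu.powers.inclusionHom.map_one, fun _ _ => hu.powers.inclusionHom.map_mul⟩,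
    fun Q n f => ?_, hrestrict, hu.powers.comparisonMap_surjective_of_restrict hrestrict⟩
  rw [hu.powers.comparisonMap_restrict Q]
  exact Iff.rfl
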